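/- Let $(\mathcal Z,\mathscr Z)$ be a measurable space and let $\mathcal F$ be a class of measurable functions $f:\mathcal Z\to[0,1]$ with finite pseudo-dimension $d\ge 1$; that is, $d$ is the largest $k$ for which there are $(z_1,w_1),\dots,(z_k,w_k)\in\mathcal Z\times\mathbb R$ with $|\{(\mathbb 1[f(z_1)\le w_1],\dots,\mathbb 1[f(z_k)\le w_k]) : f\in\mathcal F\}|=2^k$. Let $Z_1,Z_2,\dots$ be independent (not necessarily identically distributed) $\mathcal Z$-valued random variables, let $P_t$ be the law of $Z_t$, and for $t\ge 2$ let $\Delta_t\in[0,1]$ satisfy $$\sup_{f\in\mathcal F}\left|\int f\,dP_t-\int f\,dP_{t-1}\right|\le\Delta_t .$$ For each $t\ge 2$ let $$\tilde m_t\in\operatorname*{argmin}_{m\in\{1,\dots,t-1\}}\left(\sum_{q=t-m}^{t-1}\Delta_{q+1}+\sqrt{\frac dm}\right),\qquad \tilde f_t\in\operatorname*{argmin}_{f\in\mathcal F}\sum_{s=t-\tilde m_t}^{t-1}f(Z_s),$$ where the minimum over $\mathcal F$ is assumed to be attained, and let $\tilde f_1\in\mathcal F$ be arbitrary. Here each $\tilde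 f_t$ is an $\mathcal F$-valued function of the data $Z_1,\dots,Z_{t-1}$, and $\tilde f_t(z)$ is assumed to be jointly measurable in these data and in $z\in\mathcal Z$. Then there is a numerical constant $c\in(0,\infty)$, not depending on any of the above, such that for every integer $T\ge 2$ $$\sum_{t=1}^{T}\mathbb E\left[\tilde f_t(Z_t)\right]-\sum_{t=1}^{T}\inf_{f\in\mathcal F}\mathbb E\left[f(Z_t)\right]\le c\sum_{t=2}^{T}\min_{m\in\{1,\dots,t-1\}}\left(\sum_{q=t-m}^{t-1}\Delta_{q+1}+\sqrt{\frac dm}\right).$$ -/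

import Mathlib

open MeasureTheory ProbabilityTheory

/-- `d` is the pseudo-dimension of the class `F`: the largest `k` for which there are
`(z₁, w₁), …, (z_k, w_k)` whose threshold patterns `(1[f (z₁) ≤ w₁], …, 1[f (z_k) ≤ w_k])`,
for `f ∈ F`, take `2 ^ k` values. A pattern is encoded by the set of indices where it is `1`. -/
def IsPseudoDim {𝒵 : Type*} (F : Set (𝒵 → ℝ)) (d : ℕ) : Prop :=
  IsGreatest
    {k : ℕ | ∃ (z : Fin k → 𝒵) (w : Fin k → ℝ),
      ((fun f : 𝒵 → ℝ => {i : Fin k | f (z i) ≤ w i}) '' F).ncard = 2 ^ k} d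

/-- The discrepancy `ρ(P, Q) = sup_{f ∈ F} |E_P f - E_Q f|`. -/
noncomputable def discrepancy {𝒵 : Type*} [MeasurableSpace 𝒵] (F : Set (𝒵 → ℝ))
    (P Q : Measure 𝒵) : ℝ :=
  ⨆ f : F, |(∫ z, f.1 z ∂P) - (∫ z, f.1 z ∂Q)|

/-- The window criterion `∑_{q = t - m}^{t - 1} Δ_{q + 1} + √(d / m)`. -/
noncomputable def windowBound (Δ : ℕ → ℝ) (d t m : ℕ) : ℝ :=
  (∑ q ∈ Finset.Icc (t - m) (t - 1), Δ (q + 1)) + Real.sqrt ((d : ℝ) / (m : ℝ))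

/-- The data `Z₁, …, Z_{t - 1}` available before time `t`. -/
def pastData {𝒵 Ω : Type*} (Z : ℕ → Ω → 𝒵) (t : ℕ) (ω : Ω) : Finset.Ico 1 t → 𝒵 :=
  fun s => Z s ω

/-! The regret at a single time `t ≥ 2` is compared with the window criterion at `m = m t`, which is
the minimal one. The drift bounds move the risk of the predictor from the law of `Z t` back to the
average law over the window, and the risk of a competitor forward again, at the cost of
`2 ∑ Δ (q + 1)`. In between, the minimizer of the empirical risk loses only the generalization gap
between the average risk over the window and the empirical risk, which must be `O(√(d / m))` without
a logarithmic factor (`IsPseudoDim.integral_generalization_gap_le`). At time `1` nothing is known and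
the regret is at most `1`, which is at most the criterion at time `2`.

For the gap, the sample is doubled by a ghost sample, and the pairs are swapped at random
coordinatewise, which preserves their law. With the doubled sample fixed, each sign pattern `σ` makes
the predictor pick one member `g σ` of the class, so it suffices to bound the mean over `σ` of
`∑ σ i (1 - g σ (z i))` for an arbitrary selector `g` and fixed points `z i`. This deterministic
inequality replaces the supremum over the class, so that no measurability of suprema is needed.

Since `1 - g = E 1[g ≤ w]` for a uniform threshold `w`, drawn independently for each point, that
bound follows from the one for the patterns `{i | g σ (z i) ≤ w i}` with `w` fixed. These form a
family of sets whose Vapnik–Chervonenkis dimension is at most the pseudo-dimension `d`. For such a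
family the mean Rademacher sum of a selector is `O(√(d n))` by chaining
(`sum_rademacher_family_le`): a net of resolution `n 4 ^ (-j)` has at most `exp (4 d (j + 1))` members
by Dudley's random sampling argument and the Sauer–Shelah lemma (`card_le_exp_of_separated`), and
each link of the chain is controlled by Massart's finite class lemma
(`sum_rademacher_selector_le`). -/

/-! ### Rademacher sums over finite families -/

/-- The value `±1` of a Rademacher sign, encoded by a Boolean. -/
def rademacherSign (b : Bool) : ℝ := if b then 1 else -1

lemma rademacherSign_not (b : Bool) : rademacherSign (!b) = -rademacherSign b := by
  cases b <;> simp [rademacherSign]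

/-- The moment generating function of a Rademacher sum is sub-Gaussian. The sum over all
sign patterns replaces the expectation, so the factor `2 ^ |ι|` is a normalization. -/
lemma sum_exp_rademacher_le {ι : Type*} [Fintype ι] [DecidableEq ι] (x : ι → ℝ) :
    ∑ σ : ι → Bool, Real.exp (∑ i, rademacherSign (σ i) * x i) ≤
      2 ^ Fintype.card ι * Real.exp ((∑ i, x i ^ 2) / 2) := by
  have h1 : ∑ σ : ι → Bool, Real.exp (∑ i, rademacherSign (σ i) * x i) =
      ∏ i, (2 * Real.cosh (x i)) := by
    have h : ∀ i, 2 * Real.cosh (x i) = ∑ b : Bool, Real.exp (rademacherSign b * x i) := by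
      intro i
      rw [Real.cosh_eq]
      simp [rademacherSign]
      ring
    simp_rw [h, Fintype.prod_sum, Real.exp_sum]
  rw [h1, Finset.prod_mul_distrib, Finset.prod_const, Finset.card_univ, Finset.sum_div,
    Real.exp_sum]
  gcongr with i
  exact Real.cosh_le_exp_half_sq _

/-- Massart's finite class lemma, for a selector `a` that picks a member of the finite class
for each sign pattern. The parameter `l` of the exponential moment is left free. -/
lemma sum_rademacher_selector_le {ι κ : Type*} [Fintype ι] [DecidableEq ι] (N : Finset κ)
    (x : κ → ι → ℝ) {v L l : ℝ} (hv : ∀ k ∈ N, ∑ i, x k i ^ 2 ≤ v)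
    (hL : (N.card : ℝ) ≤ Real.exp L) (hl : 0 < l) (a : (ι → Bool) → κ) (ha : ∀ σ, a σ ∈ N) :
    ∑ σ : ι → Bool, ∑ i, rademacherSign (σ i) * x (a σ) i ≤
      2 ^ Fintype.card ι * (L / l + l * v / 2) := by
  set c : ℝ := L / l + l * v / 2 with hc
  have hlc : l * c = L + l ^ 2 * v / 2 := by rw [hc]; field_simp
  -- the tangent of the exponential at `l * c` replaces Jensen's inequality
  have hpt : ∀ y : ℝ, y ≤ c + (Real.exp (l * y) * Real.exp (-(l * c)) - 1) / l := by
    intro y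
    have := Real.add_one_le_exp (l * y + -(l * c))
    rw [Real.exp_add] at this
    rw [← sub_le_iff_le_add', le_div_iff₀ hl]
    linarith
  have hexp : ∑ σ : ι → Bool, Real.exp (l * ∑ i, rademacherSign (σ i) * x (a σ) i) ≤
      2 ^ Fintype.card ι * Real.exp (l * c) := by
    calc ∑ σ : ι → Bool, Real.exp (l * ∑ i, rademacherSign (σ i) * x (a σ) i)
        ≤ ∑ σ : ι → Bool, ∑ k ∈ N, Real.exp (∑ i, rademacherSign (σ i) * (l * x k i)) := by
          refine Finset.sum_le_sum fun σ _ => ?_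
          have : l * ∑ i, rademacherSign (σ i) * x (a σ) i =
              ∑ i, rademacherSign (σ i) * (l * x (a σ) i) := by
            rw [Finset.mul_sum]
            exact Finset.sum_congr rfl fun i _ => by ring
          rw [this]
          exact Finset.single_le_sum
            (f := fun k => Real.exp (∑ i, rademacherSign (σ i) * (l * x k i)))
            (fun k _ => (Real.exp_pos _).le) (ha σ)
      _ = ∑ k ∈ N, ∑ σ : ι → Bool, Real.exp (∑ i, rademacherSign (σ i) * (l * x k i)) :=
          Finset.sum_comm
      _ ≤ ∑ _k ∈ N, 2 ^ Fintype.card ι * Real.exp (l ^ 2 * v / 2) := by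
          refine Finset.sum_le_sum fun k hk => (sum_exp_rademacher_le _).trans ?_
          simp_rw [mul_pow, ← Finset.mul_sum]
          gcongr
          exact hv k hk
      _ = 2 ^ Fintype.card ι * (N.card * Real.exp (l ^ 2 * v / 2)) := by
          rw [Finset.sum_const, nsmul_eq_mul]; ring
      _ ≤ 2 ^ Fintype.card ι * Real.exp (l * c) := by
          rw [hlc, Real.exp_add]
          gcongr
  calc ∑ σ : ι → Bool, ∑ i, rademacherSign (σ i) * x (a σ) i
      ≤ ∑ σ : ι → Bool, (c + (Real.exp (l * ∑ i, rademacherSign (σ i) * x (a σ) i) *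
          Real.exp (-(l * c)) - 1) / l) := Finset.sum_le_sum fun σ _ => hpt _
    _ = 2 ^ Fintype.card ι * c +
        ((∑ σ : ι → Bool, Real.exp (l * ∑ i, rademacherSign (σ i) * x (a σ) i)) *
          Real.exp (-(l * c)) - 2 ^ Fintype.card ι) / l := by
        rw [Finset.sum_add_distrib, ← Finset.sum_div, Finset.sum_sub_distrib, ← Finset.sum_mul]
        simp
    _ ≤ 2 ^ Fintype.card ι * c +
        ((2 ^ Fintype.card ι * Real.exp (l * c)) * Real.exp (-(l * c)) - 2 ^ Fintype.card ι) / l := by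
        gcongr
    _ = 2 ^ Fintype.card ι * c := by
        rw [mul_assoc, ← Real.exp_add]; simp

/-! ### Packing numbers of families of bounded Vapnik–Chervonenkis dimension -/

open scoped symmDiff

/-- The Sauer–Shelah bound in the form `x ^ d * (1 + 1 / x) ^ |S|`, with `x ≥ 1` free. -/
lemma card_le_of_shatters_card_le {ι : Type*} [DecidableEq ι] (𝒜 : Finset (Finset ι)) {d : ℕ}
    (hd : ∀ S, 𝒜.Shatters S → S.card ≤ d) (S : Finset ι) (hS : ∀ A ∈ 𝒜, A ⊆ S) {x : ℝ}
    (hx : 1 ≤ x) : (𝒜.card : ℝ) ≤ x ^ d * (1 / x + 1) ^ S.card := by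
  have hx0 : 0 < x := by linarith
  have hsub : 𝒜.shatterer ⊆ S.powerset := by
    intro U hU
    obtain ⟨t, ht, hUt⟩ := (Finset.mem_shatterer.1 hU).exists_superset
    exact Finset.mem_powerset.2 (hUt.trans (hS t ht))
  calc (𝒜.card : ℝ) ≤ 𝒜.shatterer.card := by exact_mod_cast 𝒜.card_le_card_shatterer
    _ = ∑ U ∈ 𝒜.shatterer, (1 : ℝ) := by simp
    _ ≤ ∑ U ∈ 𝒜.shatterer, x ^ d * ((1 / x) ^ U.card * 1 ^ (S.card - U.card)) := by
        refine Finset.sum_le_sum fun U hU => ?_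
        have h := hd U (Finset.mem_shatterer.1 hU)
        rw [one_pow, mul_one, div_pow, one_pow, mul_one_div, le_div_iff₀ (by positivity), one_mul]
        exact pow_le_pow_right₀ hx h
    _ ≤ ∑ U ∈ S.powerset, x ^ d * ((1 / x) ^ U.card * 1 ^ (S.card - U.card)) :=
        Finset.sum_le_sum_of_subset_of_nonneg hsub fun _ _ _ => by positivity
    _ = x ^ d * (1 / x + 1) ^ S.card := by
        rw [← Finset.mul_sum, Finset.sum_pow_mul_eq_add_pow]

/-- If members of a family differ pairwise in at least `e * |W|` points of `W`, then for large
`k` some `k` sample points from `W` tell all members apart: a random sample does so with positive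
probability. -/
lemma exists_sample_separating {ι : Type*} [DecidableEq ι] (W : Finset ι) (hW : W.Nonempty)
    (𝒩 : Finset (Finset ι)) (hsub : ∀ A ∈ 𝒩, A ⊆ W) {e : ℝ}
    (hsep : ∀ A ∈ 𝒩, ∀ B ∈ 𝒩, A ≠ B → e * W.card ≤ ((A ∆ B).card : ℝ)) {k : ℕ}
    (hk : (𝒩.card : ℝ) ^ 2 * Real.exp (-(e * k)) ≤ 1) :
    ∃ S : Finset ι, S.card ≤ k ∧ ∀ A ∈ 𝒩, ∀ B ∈ 𝒩, A ∩ S = B ∩ S → A = B := by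
  have hn : (0 : ℝ) < W.card := by exact_mod_cast hW.card_pos
  set P := 𝒩.offDiag with hP
  -- the samples that miss the symmetric difference of a given pair
  let bad : Finset ι × Finset ι → Finset (Fin k → ι) :=
    fun p => Fintype.piFinset fun _ => W \ (p.1 ∆ p.2)
  have hbad : ∀ p ∈ P, ((bad p).card : ℝ) ≤ (W.card : ℝ) ^ k * Real.exp (-(e * k)) := by
    intro p hp
    rw [hP, Finset.mem_offDiag] at hp
    obtain ⟨h1, h2, h3⟩ := hp
    have hle : p.1 ∆ p.2 ⊆ W := fun i hi => by
      rcases Finset.mem_symmDiff.1 hi with h | h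
      · exact hsub _ h1 h.1
      · exact hsub _ h2 h.1
    have hcard : ((W \ (p.1 ∆ p.2)).card : ℝ) ≤ W.card * Real.exp (-e) := by
      rw [Finset.card_sdiff_of_subset hle, Nat.cast_sub (Finset.card_le_card hle)]
      have := hsep _ h1 _ h2 h3
      have h' := Real.add_one_le_exp (-e)
      nlinarith
    calc ((bad p).card : ℝ) = ((W \ (p.1 ∆ p.2)).card : ℝ) ^ k := by simp [bad]
      _ ≤ (W.card * Real.exp (-e)) ^ k := by gcongr
      _ = _ := by
        rw [mul_pow, ← Real.exp_nat_mul]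
        congr 2; ring
  have hlt : (P.biUnion bad).card < (Fintype.piFinset fun _ : Fin k => W).card := by
    have h1 : ((P.biUnion bad).card : ℝ) ≤
        P.card * ((W.card : ℝ) ^ k * Real.exp (-(e * k))) := by
      calc ((P.biUnion bad).card : ℝ) ≤ ∑ p ∈ P, ((bad p).card : ℝ) := by
            exact_mod_cast Finset.card_biUnion_le
        _ ≤ ∑ _p ∈ P, ((W.card : ℝ) ^ k * Real.exp (-(e * k))) := Finset.sum_le_sum hbad
        _ = _ := by rw [Finset.sum_const, nsmul_eq_mul]
    have h2 : P.card * ((W.card : ℝ) ^ k * Real.exp (-(e * k))) < (W.card : ℝ) ^ k := by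
      have hpos : 0 < (W.card : ℝ) ^ k := by positivity
      have hPc : (P.card : ℝ) * Real.exp (-(e * k)) < 1 := by
        rcases 𝒩.eq_empty_or_nonempty with h | h
        · simp [hP, h]
        · have hc : (0 : ℝ) < 𝒩.card := by exact_mod_cast h.card_pos
          have : (P.card : ℝ) < (𝒩.card : ℝ) ^ 2 := by
            rw [hP, Finset.offDiag_card, Nat.cast_sub (Nat.le_mul_self _)]
            push_cast
            nlinarith
          exact (mul_lt_mul_of_pos_right this (Real.exp_pos _)).trans_le hk
      nlinarith
    have h3 : ((Fintype.piFinset fun _ : Fin k => W).card : ℝ) = (W.card : ℝ) ^ k := by simp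
    exact_mod_cast (h1.trans_lt (h2.trans_eq h3.symm))
  obtain ⟨s, hs, hsb⟩ := Finset.exists_mem_notMem_of_card_lt_card hlt
  rw [Fintype.mem_piFinset] at hs
  refine ⟨Finset.univ.image s, Finset.card_image_le.trans (by simp), ?_⟩
  intro A hA B hB hAB
  by_contra hne
  refine hsb (Finset.mem_biUnion.2 ⟨(A, B), Finset.mem_offDiag.2 ⟨hA, hB, hne⟩, ?_⟩)
  refine Fintype.mem_piFinset.2 fun i => Finset.mem_sdiff.2 ⟨hs i, fun hi => ?_⟩
  have hmem : s i ∈ Finset.univ.image s := Finset.mem_image_of_mem _ (Finset.mem_univ _)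
  have hiff : s i ∈ A ↔ s i ∈ B := by
    have := Finset.ext_iff.1 hAB (s i)
    simpa [hmem] using this
  rcases Finset.mem_symmDiff.1 hi with h | h
  · exact h.2 (hiff.1 h.1)
  · exact h.2 (hiff.2 h.1)

/-- Dudley's packing bound: a family of subsets of `W` of dimension at most `d` whose members
differ pairwise in at least `4 ^ (-j) |W|` points has at most `exp (4 d (j + 1))` members. -/
lemma card_le_exp_of_separated {ι : Type*} [DecidableEq ι] (W : Finset ι) (hW : W.Nonempty)
    (𝒩 : Finset (Finset ι)) (hsub : ∀ A ∈ 𝒩, A ⊆ W) {d : ℕ} (hd1 : 1 ≤ d)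
    (hd : ∀ S, 𝒩.Shatters S → S.card ≤ d) (j : ℕ)
    (hsep : ∀ A ∈ 𝒩, ∀ B ∈ 𝒩, A ≠ B → (W.card : ℝ) / 4 ^ j ≤ ((A ∆ B).card : ℝ)) :
    (𝒩.card : ℝ) ≤ Real.exp (4 * d * (j + 1)) := by
  rcases 𝒩.eq_empty_or_nonempty with h | hne
  · simp [h, Real.exp_nonneg]
  have hc : (1 : ℝ) ≤ 𝒩.card := by exact_mod_cast hne.card_pos
  set L := Real.log 𝒩.card with hLdef
  have hL0 : 0 ≤ L := Real.log_nonneg hc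
  have hLe : Real.exp L = 𝒩.card := Real.exp_log (by linarith)
  set e : ℝ := 1 / 4 ^ j with he
  have he0 : 0 < e := by positivity
  have he1 : e ≤ 1 := by
    rw [he, div_le_one (by positivity)]
    exact one_le_pow₀ (by norm_num)
  set k := ⌈2 * L / e⌉₊ with hkdef
  have hk1 : 2 * L ≤ e * k := by
    have := Nat.le_ceil (2 * L / e)
    rw [div_le_iff₀ he0] at this
    linarith
  have hk2 : e * k ≤ 2 * L + e := by
    have := (Nat.ceil_lt_add_one (a := 2 * L / e) (by positivity)).le
    have h2 := mul_le_mul_of_nonneg_left this he0.le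
    rwa [mul_add, mul_div_cancel₀ _ he0.ne', mul_one] at h2
  obtain ⟨S, hSk, hS⟩ := exists_sample_separating W hW 𝒩 hsub (e := e) (k := k)
    (fun A hA B hB hAB => by
      have := hsep A hA B hB hAB
      rwa [he, one_div_mul_eq_div]) (by
      rw [← hLe, ← Real.exp_nat_mul, ← Real.exp_add]
      exact Real.exp_le_one_iff.2 (by push_cast; linarith))
  set 𝒩' := 𝒩.image (fun A => A ∩ S) with h𝒩'
  have hcard : 𝒩'.card = 𝒩.card :=
    Finset.card_image_of_injOn fun A hA B hB h => hS A hA B hB h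
  have hsub' : ∀ A ∈ 𝒩', A ⊆ S := by
    intro A hA
    obtain ⟨B, _, rfl⟩ := Finset.mem_image.1 hA
    exact Finset.inter_subset_right
  have hd' : ∀ U, 𝒩'.Shatters U → U.card ≤ d := by
    intro U hU
    have hUS : U ⊆ S := by
      obtain ⟨t, ht, hUt⟩ := hU.exists_superset
      exact hUt.trans (hsub' t ht)
    refine hd U fun t ht => ?_
    obtain ⟨u, hu, hut⟩ := hU ht
    obtain ⟨A, hA, rfl⟩ := Finset.mem_image.1 hu
    refine ⟨A, hA, ?_⟩
    rw [← hut]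
    ext i
    simp only [Finset.mem_inter]
    exact ⟨fun h => ⟨h.1, h.2, hUS h.1⟩, fun h => ⟨h.1, h.2.1⟩⟩
  -- with `x = 4 / e` the factor `(1 + 1 / x) ^ k` is at most `exp (L / 2 + 1 / 4)`, so the Sauer bound
  -- can be solved for `L`
  have hx1 : (1 : ℝ) ≤ 4 ^ (j + 1) := one_le_pow₀ (by norm_num)
  have hx0 : (0 : ℝ) < 4 ^ (j + 1) := by positivity
  have hsauer := card_le_of_shatters_card_le 𝒩' hd' S hsub' hx1
  rw [hcard] at hsauer
  have hlog4 : Real.log 4 ≤ 1.4 := by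
    have h := Real.log_two_lt_d9
    have : Real.log 4 = 2 * Real.log 2 := by
      rw [show (4 : ℝ) = 2 ^ 2 by norm_num, Real.log_pow]; norm_num
    rw [this]; linarith
  have hpow : (1 / (4 : ℝ) ^ (j + 1) + 1) ^ S.card ≤ Real.exp (L / 2 + 1 / 4) := by
    calc (1 / (4 : ℝ) ^ (j + 1) + 1) ^ S.card
        ≤ (1 / (4 : ℝ) ^ (j + 1) + 1) ^ k := by
          refine pow_le_pow_right₀ ?_ hSk
          have : 0 < 1 / (4 : ℝ) ^ (j + 1) := by positivity
          linarith
      _ ≤ (Real.exp (1 / (4 : ℝ) ^ (j + 1))) ^ k := by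
          gcongr
          exact Real.add_one_le_exp _
      _ = Real.exp (e * k / 4) := by
          rw [← Real.exp_nat_mul, he]
          congr 1
          rw [pow_succ]
          field_simp
      _ ≤ _ := Real.exp_le_exp.2 (by linarith)
  have hL : L ≤ d * ((j + 1) * Real.log 4) + (L / 2 + 1 / 4) := by
    rw [← Real.exp_le_exp, Real.exp_add, hLe]
    refine hsauer.trans ?_
    have : ((4 : ℝ) ^ (j + 1)) ^ d = Real.exp (d * ((j + 1) * Real.log 4)) := by
      rw [Real.exp_nat_mul, ← Nat.cast_succ, Real.exp_nat_mul, Real.exp_log (by norm_num)]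
    rw [this]
    gcongr
  rw [← hLe]
  refine Real.exp_le_exp.2 ?_
  have hd1' : (1 : ℝ) ≤ d := by exact_mod_cast hd1
  have hj : (0 : ℝ) ≤ j := by positivity
  have hdj : (1 : ℝ) ≤ d * (j + 1) := by nlinarith
  have : d * ((j + 1) * Real.log 4) ≤ d * (j + 1) * 1.4 := by
    rw [← mul_assoc]; gcongr
  nlinarith

/-! ### Chaining -/

lemma exists_maximal_separated {ι : Type*} [DecidableEq ι] (𝒜 : Finset (Finset ι)) (r : ℝ)
    (hr : 0 ≤ r) :
    ∃ 𝒩 ⊆ 𝒜, (∀ A ∈ 𝒩, ∀ B ∈ 𝒩, A ≠ B → r < ((A ∆ B).card : ℝ)) ∧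
      ∀ A ∈ 𝒜, ∃ B ∈ 𝒩, ((A ∆ B).card : ℝ) ≤ r := by
  classical
  let 𝒮 := 𝒜.powerset.filter
    fun 𝒩 => ∀ A ∈ 𝒩, ∀ B ∈ 𝒩, A ≠ B → r < ((A ∆ B).card : ℝ)
  have h𝒮 : 𝒮.Nonempty := ⟨∅, by simp [𝒮]⟩
  obtain ⟨𝒩, h𝒩, hmax⟩ := 𝒮.exists_max_image Finset.card h𝒮
  obtain ⟨hsub, hsep⟩ := Finset.mem_filter.1 h𝒩
  rw [Finset.mem_powerset] at hsub
  refine ⟨𝒩, hsub, hsep, fun A hA => ?_⟩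
  by_contra! hcon
  have hAn : A ∉ 𝒩 := fun h => by
    have := hcon A h
    simp at this
    linarith
  have hins : insert A 𝒩 ∈ 𝒮 := by
    refine Finset.mem_filter.2 ⟨Finset.mem_powerset.2 (Finset.insert_subset hA hsub), ?_⟩
    intro B hB C hC hBC
    rcases Finset.mem_insert.1 hB with rfl | hB' <;>
      rcases Finset.mem_insert.1 hC with rfl | hC'
    · exact absurd rfl hBC
    · exact hcon C hC'
    · rw [symmDiff_comm]; exact hcon B hB'
    · exact hsep B hB' C hC' hBC
  have := hmax _ hins
  rw [Finset.card_insert_of_notMem hAn] at this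
  omega

/-- Chaining along nets of resolution `4 ^ (-j)`: a selector from a family of subsets of `W` of
dimension at most `d` has mean Rademacher sum `O(√(d |W|))`, without a logarithm. -/
lemma sum_rademacher_family_le {ι : Type*} [Fintype ι] [DecidableEq ι] (W : Finset ι)
    (𝒜 : Finset (Finset ι)) (hsub : ∀ A ∈ 𝒜, A ⊆ W) {d : ℕ} (hd1 : 1 ≤ d)
    (hd : ∀ S, 𝒜.Shatters S → S.card ≤ d) (a : (ι → Bool) → Finset ι) (ha : ∀ σ, a σ ∈ 𝒜) :
    ∑ σ : ι → Bool, ∑ i ∈ a σ, rademacherSign (σ i) ≤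
      2 ^ Fintype.card ι * (30 * Real.sqrt (d * W.card)) := by
  rcases W.eq_empty_or_nonempty with rfl | hW
  · have : ∀ σ, a σ = ∅ := fun σ => Finset.subset_empty.1 (hsub _ (ha σ))
    simp [this]
  have hn : (1 : ℝ) ≤ W.card := by exact_mod_cast hW.card_pos
  have hn0 : (0 : ℝ) < W.card := by linarith
  have hd1' : (1 : ℝ) ≤ d := by exact_mod_cast hd1
  have hd0 : (0 : ℝ) < d := by linarith
  choose N hNsub hNsep hNnet using fun j : ℕ =>
    exists_maximal_separated 𝒜 ((W.card : ℝ) / 4 ^ j) (by positivity)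
  have hNcard : ∀ j, ((N j).card : ℝ) ≤ Real.exp (4 * d * (j + 1)) := fun j =>
    card_le_exp_of_separated W hW (N j) (fun A hA => hsub A (hNsub j hA)) hd1
      (fun S hS => hd S (hS.mono_left (hNsub j))) j
      (fun A hA B hB hAB => (hNsep j A hA B hB hAB).le)
  set R := Real.sqrt (d * W.card) with hR
  -- the base exponential parameter; the link into the net of index `j + 1` uses `l * 2 ^ j`
  set l := Real.sqrt (d / W.card) with hl
  have hl0 : 0 < l := Real.sqrt_pos.2 (by positivity)
  have hdl : d / l = R := by
    rw [div_eq_iff hl0.ne', hR, hl, ← Real.sqrt_mul (by positivity)]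
    rw [show (d * W.card * (d / W.card) : ℝ) = d ^ 2 by field_simp, Real.sqrt_sq hd0.le]
  have hln : l * W.card = R := by
    rw [← hdl, eq_div_iff hl0.ne', mul_right_comm, hl, Real.mul_self_sqrt (by positivity)]
    field_simp
  have hind : ∀ (A : Finset ι) (σ : ι → Bool), ∑ i ∈ A, rademacherSign (σ i) =
      ∑ i, rademacherSign (σ i) * (if i ∈ A then 1 else 0) := by
    intro A σ; simp
  -- the link into the net of index `j + 1` costs `(4 (j + 2) + 1 / 2) / 2 ^ j * R`, which is the
  -- increment of `(30 - (8 j + 25) / 2 ^ j) * R`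
  have key : ∀ j : ℕ, ∀ b : (ι → Bool) → Finset ι, (∀ σ, b σ ∈ N j) →
      ∑ σ : ι → Bool, ∑ i ∈ b σ, rademacherSign (σ i) ≤
        2 ^ Fintype.card ι * ((30 - (8 * j + 25) / 2 ^ j) * R) := by
    intro j
    induction j with
    | zero =>
      intro b hb
      have h := sum_rademacher_selector_le (N 0)
        (fun (A : Finset ι) i => if i ∈ A then (1 : ℝ) else 0) (v := W.card) (L := 4 * d)
        (fun A hA => by
          have := Finset.card_le_card (hsub A (hNsub 0 hA))
          simpa using this)
        (by simpa using hNcard 0) hl0 b hb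
      simp_rw [hind]
      refine h.trans ?_
      rw [mul_div_assoc, hdl, hln]
      have hR0 : 0 ≤ R := Real.sqrt_nonneg _
      gcongr
      norm_num
      linarith
    | succ j ih =>
      intro b hb
      choose p hp hpd using fun A : 𝒜 => hNnet j A.1 A.2
      let q : Finset ι → Finset ι := fun A => if h : A ∈ 𝒜 then p ⟨A, h⟩ else A
      have hq : ∀ A ∈ 𝒜, q A ∈ N j ∧ ((A ∆ q A).card : ℝ) ≤ W.card / 4 ^ j := by
        intro A hA
        simp only [q, dif_pos hA]
        exact ⟨hp ⟨A, hA⟩, hpd ⟨A, hA⟩⟩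
      have h1 := ih (fun σ => q (b σ)) fun σ => (hq _ (hNsub _ (hb σ))).1
      have h2 := sum_rademacher_selector_le (N (j + 1))
        (fun (A : Finset ι) i => (if i ∈ A then (1 : ℝ) else 0) - if i ∈ q A then 1 else 0)
        (v := W.card / 4 ^ j) (L := 4 * d * (j + 2)) (l := l * 2 ^ j)
        (fun A hA => by
          refine le_trans (le_of_eq ?_) (hq A (hNsub _ hA)).2
          rw [Finset.card_eq_sum_ones, Nat.cast_sum, ← Finset.sum_filter_add_sum_filter_not
            Finset.univ (fun i => i ∈ A ∆ q A), Finset.filter_mem_eq_inter, Finset.univ_inter]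
          rw [Finset.sum_eq_zero (s := Finset.filter _ _), add_zero]
          · refine Finset.sum_congr rfl fun i hi => ?_
            rcases Finset.mem_symmDiff.1 hi with h | h <;> simp [h.1, h.2]
          · intro i hi
            have hi := (Finset.mem_filter.1 hi).2
            rw [Finset.mem_symmDiff] at hi
            by_cases h3 : i ∈ A <;> by_cases h4 : i ∈ q A <;> simp_all)
        (by
          have := hNcard (j + 1)
          push_cast at this
          rwa [add_assoc, one_add_one_eq_two] at this) (by positivity) b hb
      have hsplit : ∑ σ : ι → Bool, ∑ i ∈ b σ, rademacherSign (σ i) =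
          ∑ σ : ι → Bool, ∑ i ∈ q (b σ), rademacherSign (σ i) +
          ∑ σ : ι → Bool, ∑ i, rademacherSign (σ i) *
            ((if i ∈ b σ then (1 : ℝ) else 0) - if i ∈ q (b σ) then 1 else 0) := by
        simp_rw [hind, mul_sub, Finset.sum_sub_distrib]
        ring
      rw [hsplit]
      refine (add_le_add h1 h2).trans (le_of_eq ?_)
      have e1 : 4 * (d : ℝ) * (j + 2) / (l * 2 ^ j) = 4 * (j + 2) / 2 ^ j * R := by
        rw [← hdl]; field_simp
      have e2 : l * 2 ^ j * (W.card / 4 ^ j) / 2 = 1 / 2 / 2 ^ j * R := by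
        rw [← hln, show (4 : ℝ) ^ j = 2 ^ j * 2 ^ j by rw [← mul_pow]; norm_num]; field_simp
      rw [e1, e2, ← mul_add, ← add_mul, ← add_mul]
      push_cast
      rw [pow_succ]
      field_simp
      ring
  -- below resolution one the net is the whole family
  obtain ⟨J, hJ⟩ := pow_unbounded_of_one_lt (W.card : ℝ) (by norm_num : (1 : ℝ) < 4)
  have haN : ∀ σ, a σ ∈ N J := by
    intro σ
    obtain ⟨B, hB, hBd⟩ := hNnet J (a σ) (ha σ)
    have : ((a σ ∆ B).card : ℝ) < 1 :=
      hBd.trans_lt ((div_lt_one (by positivity)).2 hJ)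
    have h0 : (a σ ∆ B).card = 0 := by
      have : (a σ ∆ B).card < 1 := by exact_mod_cast this
      omega
    rw [Finset.card_eq_zero] at h0
    rwa [symmDiff_eq_bot.1 h0]
  refine (key J a haN).trans ?_
  have : (0 : ℝ) ≤ (8 * J + 25) / 2 ^ J := by positivity
  gcongr
  linarith

/-! ### Rademacher sums over a class of finite pseudo-dimension -/

lemma IsPseudoDim.card_le_of_shatters {𝒵 ι : Type*} [DecidableEq ι] {F : Set (𝒵 → ℝ)} {d : ℕ}
    (hF : IsPseudoDim F d) (z : ι → 𝒵) (w : ι → ℝ) (W : Finset ι) (𝒜 : Finset (Finset ι))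
    (h𝒜 : ∀ A ∈ 𝒜, ∃ f ∈ F, ∀ i, i ∈ A ↔ i ∈ W ∧ f (z i) ≤ w i) (S : Finset ι)
    (hS : 𝒜.Shatters S) : S.card ≤ d := by
  classical
  have hSW : S ⊆ W := by
    obtain ⟨A, hA, hSA⟩ := hS.exists_superset
    obtain ⟨f, _, hf⟩ := h𝒜 A hA
    exact fun i hi => ((hf i).1 (hSA hi)).1
  let e := S.equivFin.symm
  refine hF.2 ⟨fun i => z (e i), fun i => w (e i), ?_⟩
  have huniv : (fun f : 𝒵 → ℝ => {i : Fin S.card | f (z (e i)) ≤ w (e i)}) '' F = Set.univ := by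
    refine Set.eq_univ_of_forall fun U => ?_
    let t : Finset ι := (Finset.univ.filter (· ∈ U)).image fun i => (e i : ι)
    have ht : t ⊆ S := by
      intro i hi
      obtain ⟨k, _, rfl⟩ := Finset.mem_image.1 hi
      exact (e k).2
    obtain ⟨A, hA, hAt⟩ := hS ht
    obtain ⟨f, hf, hfA⟩ := h𝒜 A hA
    refine ⟨f, hf, ?_⟩
    ext k
    have h1 : (e k : ι) ∈ A ↔ (e k : ι) ∈ t := by
      rw [← hAt]; simp
    have h2 : (e k : ι) ∈ t ↔ k ∈ U := by
      simp only [t, Finset.mem_image, Finset.mem_filter, Finset.mem_univ, true_and]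
      constructor
      · rintro ⟨k', hk', h⟩
        rwa [← e.injective (Subtype.ext h)]
      · exact fun h => ⟨k, h, rfl⟩
    rw [Set.mem_ofPred_eq, ← h2, ← h1, hfA]
    exact ⟨fun h => ⟨hSW (e k).2, h⟩, fun h => h.2⟩
  rw [huniv, Set.ncard_univ, Nat.card_eq_fintype_card, Fintype.card_set, Fintype.card_fin]

/-- For fixed thresholds, the mean Rademacher sum of the threshold patterns of a selector
is at most `30 √(d |W|)` in absolute value. -/
lemma IsPseudoDim.abs_sum_rademacher_threshold_le {𝒵 ι : Type*} [Fintype ι] [DecidableEq ι]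
    {F : Set (𝒵 → ℝ)} {d : ℕ} (hF : IsPseudoDim F d) (hd1 : 1 ≤ d) (W : Finset ι) (z : ι → 𝒵)
    (w : ι → ℝ) (g : (ι → Bool) → 𝒵 → ℝ) (hg : ∀ σ, g σ ∈ F) :
    |∑ σ : ι → Bool, ∑ i ∈ W, rademacherSign (σ i) * (if g σ (z i) ≤ w i then 1 else 0)| ≤
      2 ^ Fintype.card ι * (30 * Real.sqrt (d * W.card)) := by
  classical
  let a : (ι → Bool) → Finset ι := fun σ => W.filter fun i => g σ (z i) ≤ w i
  let 𝒜 : Finset (Finset ι) := Finset.univ.image a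
  have hsub : ∀ A ∈ 𝒜, A ⊆ W := by
    intro A hA
    obtain ⟨σ, _, rfl⟩ := Finset.mem_image.1 hA
    exact Finset.filter_subset _ _
  have hd := hF.card_le_of_shatters z w W 𝒜 (by
    intro A hA
    obtain ⟨σ, _, rfl⟩ := Finset.mem_image.1 hA
    exact ⟨g σ, hg σ, fun i => Finset.mem_filter⟩)
  have ha : ∀ σ, a σ ∈ 𝒜 := fun σ => Finset.mem_image_of_mem _ (Finset.mem_univ _)
  have hsum : ∀ σ, ∑ i ∈ W, rademacherSign (σ i) * (if g σ (z i) ≤ w i then 1 else 0) =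
      ∑ i ∈ a σ, rademacherSign (σ i) := by
    intro σ
    simp [a, Finset.sum_filter]
  simp_rw [hsum]
  rw [abs_le']
  refine ⟨sum_rademacher_family_le W 𝒜 hsub hd1 hd a ha, ?_⟩
  -- the lower bound is the upper bound for the flipped signs
  let ν : Equiv.Perm (ι → Bool) :=
    ⟨fun σ i => !σ i, fun σ i => !σ i, fun σ => by simp, fun σ => by simp⟩
  have h := sum_rademacher_family_le W 𝒜 hsub hd1 hd (fun σ => a (ν σ)) fun σ => ha _
  rw [← Equiv.sum_comp ν] at h
  have hν : ∀ σ, ν (ν σ) = σ := fun σ => by ext i; simp [ν]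
  simp_rw [hν] at h
  rw [← Finset.sum_neg_distrib]
  refine le_trans (le_of_eq ?_) h
  refine Finset.sum_congr rfl fun σ _ => ?_
  rw [← Finset.sum_neg_distrib]
  exact Finset.sum_congr rfl fun i _ => (rademacherSign_not _).symm

lemma integral_pi_unitInterval_threshold {ι : Type*} [Fintype ι] (i : ι) {c : ℝ}
    (hc : c ∈ Set.Icc (0 : ℝ) 1) :
    Integrable (fun w : ι → unitInterval => if c ≤ w i then (1 : ℝ) else 0) ∧
      ∫ w : ι → unitInterval, (if c ≤ w i then (1 : ℝ) else 0) = 1 - c := by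
  have hset : MeasurableSet {w : ι → unitInterval | c ≤ w i} :=
    measurableSet_le measurable_const (by fun_prop)
  have hind : (fun w : ι → unitInterval => if c ≤ w i then (1 : ℝ) else 0) =
      Set.indicator {w : ι → unitInterval | c ≤ w i} fun _ => 1 := by
    ext w; simp [Set.indicator]
  have hvol : volume {w : ι → unitInterval | c ≤ w i} = ENNReal.ofReal (1 - c) := by
    have h := (measurePreserving_eval (fun _ : ι => (volume : Measure unitInterval)) i).measure_preimage
      (s := Set.Ici ⟨c, hc⟩) measurableSet_Ici.nullMeasurableSet
    rw [unitInterval.volume_Ici] at h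
    exact h
  refine ⟨?_, ?_⟩
  · rw [hind]
    exact (integrable_const (1 : ℝ)).indicator hset
  · rw [hind, integral_indicator_const _ hset, Measure.real, hvol,
      ENNReal.toReal_ofReal (by linarith [hc.2])]
    simp

/-- A uniform random threshold `w` turns `1 - g` into the mean of the pattern `1[g ≤ w]`, so the
bound for threshold patterns passes to the functions themselves. -/
lemma IsPseudoDim.abs_sum_rademacher_le {𝒵 ι : Type*} [Fintype ι] [DecidableEq ι]
    {F : Set (𝒵 → ℝ)} (hF01 : ∀ f ∈ F, ∀ z, f z ∈ Set.Icc (0 : ℝ) 1) {d : ℕ}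
    (hF : IsPseudoDim F d) (hd1 : 1 ≤ d) (W : Finset ι) (z : ι → 𝒵)
    (g : (ι → Bool) → 𝒵 → ℝ) (hg : ∀ σ, g σ ∈ F) :
    |∑ σ : ι → Bool, ∑ i ∈ W, rademacherSign (σ i) * (1 - g σ (z i))| ≤
      2 ^ Fintype.card ι * (30 * Real.sqrt (d * W.card)) := by
  have hint := fun (σ : ι → Bool) (i : ι) =>
    integral_pi_unitInterval_threshold i (hF01 (g σ) (hg σ) (z i))
  have heq : ∑ σ : ι → Bool, ∑ i ∈ W, rademacherSign (σ i) * (1 - g σ (z i)) =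
      ∫ w : ι → unitInterval, ∑ σ : ι → Bool, ∑ i ∈ W,
        rademacherSign (σ i) * (if g σ (z i) ≤ w i then 1 else 0) := by
    rw [integral_finsetSum _ fun σ _ => integrable_finsetSum _ fun i _ =>
      (hint σ i).1.const_mul _]
    refine Finset.sum_congr rfl fun σ _ => ?_
    rw [integral_finsetSum _ fun i _ => (hint σ i).1.const_mul _]
    refine Finset.sum_congr rfl fun i _ => ?_
    rw [integral_const_mul, (hint σ i).2]
  rw [heq]
  rw [← Real.norm_eq_abs]
  refine (norm_integral_le_of_norm_le_const (ae_of_all _ fun w =>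
    hF.abs_sum_rademacher_threshold_le hd1 W z (fun i => (w i : ℝ)) g hg)).trans (le_of_eq ?_)
  rw [probReal_univ, mul_one]

/-! ### Symmetrization for a data-dependent predictor -/

lemma integrable_of_mem_Icc {α : Type*} [MeasurableSpace α] {μ : Measure α}
    [IsFiniteMeasure μ] {f : α → ℝ} (hf : Measurable f) (h01 : ∀ a, f a ∈ Set.Icc (0 : ℝ) 1) :
    Integrable f μ :=
  Integrable.of_mem_Icc 0 1 hf.aemeasurable (ae_of_all _ h01)

lemma integral_mem_Icc_of_mem_Icc {α : Type*} [MeasurableSpace α] {μ : Measure α}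
    [IsProbabilityMeasure μ] {f : α → ℝ} (hf : Measurable f)
    (h01 : ∀ a, f a ∈ Set.Icc (0 : ℝ) 1) : (∫ a, f a ∂μ) ∈ Set.Icc (0 : ℝ) 1 := by
  refine ⟨integral_nonneg fun a => (h01 a).1, ?_⟩
  refine (integral_mono (integrable_of_mem_Icc hf h01) (integrable_const 1)
    fun a => (h01 a).2).trans ?_
  simp

/-- The expected generalization gap of a predictor `h x`, chosen from the class after seeing the
independent sample `x`, is at most `60 √(d |W|)` over the window `W`. The predictor is evaluated
along random swaps of the sample with a ghost sample; each swap pattern yields one member of the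
class, so no supremum over the class and no measurability of it enters. -/
lemma IsPseudoDim.integral_generalization_gap_le {𝒵 ι : Type*} [MeasurableSpace 𝒵] [Fintype ι]
    [DecidableEq ι] {F : Set (𝒵 → ℝ)} (hF01 : ∀ f ∈ F, ∀ z, f z ∈ Set.Icc (0 : ℝ) 1) {d : ℕ}
    (hF : IsPseudoDim F d) (hd1 : 1 ≤ d) (P : ι → Measure 𝒵) [∀ i, IsProbabilityMeasure (P i)]
    (W : Finset ι) (h : (ι → 𝒵) → 𝒵 → ℝ) (hh : ∀ x, h x ∈ F)
    (hm : Measurable fun p : (ι → 𝒵) × 𝒵 => h p.1 p.2) :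
    ∫ x, ∑ s ∈ W, ((∫ z, h x z ∂P s) - h x (x s)) ∂Measure.pi P ≤
      60 * Real.sqrt (d * W.card) := by
  have h01 : ∀ x z, h x z ∈ Set.Icc (0 : ℝ) 1 := fun x => hF01 _ (hh x)
  set ν := Measure.pi P with hν
  set ρ := Measure.pi fun i => (P i).prod (P i) with hρ
  let G : (ι → 𝒵 × 𝒵) → ℝ := fun y =>
    ∑ s ∈ W, (h (fun i => (y i).1) (y s).2 - h (fun i => (y i).1) (y s).1)
  have hGmeas : Measurable G := by
    refine Finset.measurable_sum _ fun s _ => Measurable.sub ?_ ?_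
    · exact hm.comp (f := fun y : ι → 𝒵 × 𝒵 => ((fun i => (y i).1 : ι → 𝒵), (y s).2))
        (by fun_prop)
    · exact hm.comp (f := fun y : ι → 𝒵 × 𝒵 => ((fun i => (y i).1 : ι → 𝒵), (y s).1))
        (by fun_prop)
  have hGbd : ∀ y, G y ∈ Set.Icc (-(W.card : ℝ)) W.card := by
    intro y
    rw [Set.mem_Icc, ← abs_le]
    refine (Finset.abs_sum_le_sum_abs _ _).trans ?_
    refine (Finset.sum_le_card_nsmul W _ 1 fun s _ => ?_).trans (by simp)
    have h1 := h01 (fun i => (y i).1) (y s).1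
    have h2 := h01 (fun i => (y i).1) (y s).2
    rw [abs_le]
    constructor <;> linarith [h1.1, h1.2, h2.1, h2.2]
  have hGint : ∀ f : (ι → 𝒵 × 𝒵) → (ι → 𝒵 × 𝒵), Measurable f → Integrable (fun y => G (f y)) ρ :=
    fun f hf => Integrable.of_mem_Icc _ _ (hGmeas.comp hf).aemeasurable
      (ae_of_all _ fun y => hGbd (f y))
  -- the gap is the mean of `G` over the sample and an independent copy
  have hghost : ∫ x, ∑ s ∈ W, ((∫ z, h x z ∂P s) - h x (x s)) ∂ν = ∫ y, G y ∂ρ := by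
    have hmp := measurePreserving_arrowProdEquivProdArrow 𝒵 𝒵 ι P P
    let K : (ι → 𝒵) × (ι → 𝒵) → ℝ := fun p => ∑ s ∈ W, (h p.1 (p.2 s) - h p.1 (p.1 s))
    have hGK : G = fun y => K (MeasurableEquiv.arrowProdEquivProdArrow 𝒵 𝒵 ι y) := rfl
    have hKint : Integrable K (ν.prod ν) := by
      refine (hmp.integrable_comp_emb (MeasurableEquiv.measurableEmbedding _)).1 ?_
      exact hGint id measurable_id
    rw [hGK, hmp.integral_comp', integral_prod _ hKint]
    refine integral_congr_ae (ae_of_all _ fun x => ?_)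
    have hhx : Measurable (h x) := hm.comp measurable_prodMk_left
    have hi : ∀ s, Integrable (fun x' : ι → 𝒵 => h x (x' s)) ν := fun s =>
      integrable_of_mem_Icc (hhx.comp (measurable_pi_apply s)) fun _ => h01 _ _
    have hi' : ∀ s ∈ W, Integrable (fun x' : ι → 𝒵 => h x (x' s) - h x (x s)) ν :=
      fun s _ => (hi s).sub (integrable_const _)
    simp only [K]
    rw [integral_finsetSum _ hi']
    refine Finset.sum_congr rfl fun s _ => ?_
    rw [integral_sub (hi s) (integrable_const _), integral_const, probReal_univ, one_smul,
      ← (measurePreserving_eval P s).map_eq, integral_map (measurable_pi_apply s).aemeasurable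
        hhx.aestronglyMeasurable]
  -- coordinatewise swaps preserve the law of the doubled sample
  let τ : (ι → Bool) → (ι → 𝒵 × 𝒵) → (ι → 𝒵 × 𝒵) :=
    fun σ y i => (if σ i then id else Prod.swap) (y i)
  have hτ : ∀ σ, MeasurePreserving (τ σ) ρ ρ := fun σ =>
    measurePreserving_pi _ _ (f := fun i => if σ i then id else Prod.swap) fun i => by
      by_cases hi : σ i
      · simpa [hi] using MeasurePreserving.id _
      · simpa [hi] using Measure.measurePreserving_swap (μ := P i) (ν := P i)
  have hswap : ∀ σ, ∫ y, G (τ σ y) ∂ρ = ∫ y, G y ∂ρ := by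
    intro σ
    conv_rhs => rw [← (hτ σ).map_eq]
    rw [integral_map (hτ σ).measurable.aemeasurable hGmeas.aestronglyMeasurable]
  have hpt : ∀ y, ∑ σ : ι → Bool, G (τ σ y) ≤
      2 ^ Fintype.card ι * (60 * Real.sqrt (d * W.card)) := by
    intro y
    let g : (ι → Bool) → 𝒵 → ℝ := fun σ => h fun i => (τ σ y i).1
    have h1 := hF.abs_sum_rademacher_le hF01 hd1 W (fun i => (y i).1) g fun σ => hh _
    have h2 := hF.abs_sum_rademacher_le hF01 hd1 W (fun i => (y i).2) g fun σ => hh _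
    have hG : ∀ σ, G (τ σ y) = ∑ i ∈ W, rademacherSign (σ i) * (1 - g σ (y i).1) -
        ∑ i ∈ W, rademacherSign (σ i) * (1 - g σ (y i).2) := by
      intro σ
      rw [← Finset.sum_sub_distrib]
      refine Finset.sum_congr rfl fun i _ => ?_
      by_cases hi : σ i <;> simp [g, τ, hi, rademacherSign]
    simp_rw [hG]
    rw [Finset.sum_sub_distrib]
    linarith [(abs_le.1 h1).2, (abs_le.1 h2).1]
  have hsum : 2 ^ Fintype.card ι * ∫ y, G y ∂ρ ≤
      2 ^ Fintype.card ι * (60 * Real.sqrt (d * W.card)) := by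
    calc 2 ^ Fintype.card ι * ∫ y, G y ∂ρ = ∑ σ : ι → Bool, ∫ y, G (τ σ y) ∂ρ := by
          simp_rw [hswap]; simp
      _ = ∫ y, ∑ σ : ι → Bool, G (τ σ y) ∂ρ :=
          (integral_finsetSum _ fun σ _ => hGint _ (hτ σ).measurable).symm
      _ ≤ ∫ _y, 2 ^ Fintype.card ι * (60 * Real.sqrt (d * W.card)) ∂ρ :=
          integral_mono (integrable_finsetSum _ fun σ _ => hGint _ (hτ σ).measurable)
            (integrable_const _) hpt
      _ = _ := by rw [integral_const, probReal_univ, one_smul]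
  rw [hghost]
  exact le_of_mul_le_mul_left hsum (by positivity)

/-! ### Drift of the laws -/

lemma abs_integral_sub_integral_le_discrepancy {𝒵 : Type*} [MeasurableSpace 𝒵] {F : Set (𝒵 → ℝ)}
    (hF : ∀ f ∈ F, Measurable f ∧ ∀ z, f z ∈ Set.Icc (0 : ℝ) 1) (P Q : Measure 𝒵)
    [IsProbabilityMeasure P] [IsProbabilityMeasure Q] {g : 𝒵 → ℝ} (hg : g ∈ F) :
    |(∫ z, g z ∂P) - ∫ z, g z ∂Q| ≤ discrepancy F P Q := by
  have hbdd : BddAbove (Set.range fun f : F => |(∫ z, f.1 z ∂P) - ∫ z, f.1 z ∂Q|) := by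
    refine ⟨1, ?_⟩
    rintro _ ⟨f, rfl⟩
    have h1 := integral_mem_Icc_of_mem_Icc (μ := P) (hF f.1 f.2).1 (hF f.1 f.2).2
    have h2 := integral_mem_Icc_of_mem_Icc (μ := Q) (hF f.1 f.2).1 (hF f.1 f.2).2
    rw [abs_le]
    constructor <;> linarith [h1.1, h1.2, h2.1, h2.2]
  exact le_ciSup hbdd ⟨g, hg⟩

lemma abs_integral_sub_integral_le_sum_drift {𝒵 : Type*} [MeasurableSpace 𝒵] {F : Set (𝒵 → ℝ)}
    (hF : ∀ f ∈ F, Measurable f ∧ ∀ z, f z ∈ Set.Icc (0 : ℝ) 1) (P : ℕ → Measure 𝒵)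
    (hP : ∀ t, 1 ≤ t → IsProbabilityMeasure (P t)) (Δ : ℕ → ℝ)
    (hΔ : ∀ t, 2 ≤ t → discrepancy F (P t) (P (t - 1)) ≤ Δ t) {g : 𝒵 → ℝ} (hg : g ∈ F)
    {s t : ℕ} (hs : 1 ≤ s) (hst : s ≤ t) :
    |(∫ z, g z ∂P t) - ∫ z, g z ∂P s| ≤ ∑ q ∈ Finset.Ico s t, Δ (q + 1) := by
  induction t, hst using Nat.le_induction with
  | base => simp
  | succ t hst ih =>
    rw [Finset.sum_Ico_succ_top hst]
    have := hP (t + 1) (by omega)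
    have := hP t (by omega)
    have h := (abs_integral_sub_integral_le_discrepancy hF (P (t + 1)) (P t) hg).trans
      (hΔ (t + 1) (by omega))
    calc |(∫ z, g z ∂P (t + 1)) - ∫ z, g z ∂P s|
        ≤ |(∫ z, g z ∂P (t + 1)) - ∫ z, g z ∂P t| + |(∫ z, g z ∂P t) - ∫ z, g z ∂P s| :=
          abs_sub_le _ _ _
      _ ≤ _ := by linarith

/-! ### Law of the data -/

lemma measurable_pastData {𝒵 Ω : Type*} [MeasurableSpace 𝒵] [MeasurableSpace Ω]
    {Z : ℕ → Ω → 𝒵} (hZ : ∀ t, 1 ≤ t → Measurable (Z t)) (t : ℕ) : Measurable (pastData Z t) :=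
  measurable_pi_lambda _ fun s => hZ s (Finset.mem_Ico.1 s.2).1

lemma map_pastData_eq_pi {𝒵 Ω : Type*} [MeasurableSpace 𝒵] [MeasurableSpace Ω]
    {μ : Measure Ω} [IsProbabilityMeasure μ] {Z : ℕ → Ω → 𝒵}
    (hZ : ∀ t, 1 ≤ t → Measurable (Z t)) (hind : iIndepFun (fun t : ℕ+ => Z (t : ℕ)) μ) (t : ℕ) :
    μ.map (pastData Z t) = Measure.pi fun s : Finset.Ico 1 t => μ.map (Z s) := by
  let j : Finset.Ico 1 t → ℕ+ := fun s => ⟨s, (Finset.mem_Ico.1 s.2).1⟩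
  have hj : Function.Injective j := fun a b hab => Subtype.ext (congrArg PNat.val hab)
  exact (iIndepFun_iff_map_fun_eq_pi_map
    (fun s : Finset.Ico 1 t => (hZ s (Finset.mem_Ico.1 s.2).1).aemeasurable)).1 (hind.precomp hj)

lemma map_pastData_prodMk {𝒵 Ω : Type*} [MeasurableSpace 𝒵] [MeasurableSpace Ω]
    {μ : Measure Ω} [IsProbabilityMeasure μ] {Z : ℕ → Ω → 𝒵}
    (hZ : ∀ t, 1 ≤ t → Measurable (Z t)) (hind : iIndepFun (fun t : ℕ+ => Z (t : ℕ)) μ) {t : ℕ}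
    (ht : 1 ≤ t) :
    μ.map (fun ω => (pastData Z t ω, Z t ω)) =
      (Measure.pi fun s : Finset.Ico 1 t => μ.map (Z s)).prod (μ.map (Z t)) := by
  classical
  rw [← map_pastData_eq_pi hZ hind t]
  let j : Finset.Ico 1 t → ℕ+ := fun s => ⟨s, (Finset.mem_Ico.1 s.2).1⟩
  let S : Finset ℕ+ := Finset.univ.image j
  let t' : ℕ+ := ⟨t, ht⟩
  have hdisj : Disjoint S {t'} := by
    rw [Finset.disjoint_singleton_right]
    intro h
    obtain ⟨s, _, hs⟩ := Finset.mem_image.1 h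
    have h1 : (s : ℕ) = t := congrArg PNat.val hs
    have h2 := (Finset.mem_Ico.1 s.2).2
    omega
  have h := hind.indepFun_finset S {t'} hdisj fun i => hZ i i.pos
  have h2 : IndepFun (pastData Z t) (Z t) μ :=
    h.comp (φ := fun (u : S → 𝒵) (s : Finset.Ico 1 t) =>
        u ⟨j s, Finset.mem_image_of_mem _ (Finset.mem_univ _)⟩)
      (ψ := fun u : ({t'} : Finset ℕ+) → 𝒵 => u ⟨t', Finset.mem_singleton_self _⟩)
      (by fun_prop) (by fun_prop)
  exact (indepFun_iff_map_prod_eq_prod_map_map (measurable_pastData hZ t).aemeasurable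
    (hZ t ht).aemeasurable).1 h2

/-! ### Regret of the adaptive window -/

/-- Excess risk at one time, for empirical risk minimization over a window of length `m`: twice
the drift across the window, once to move the predictor's risk back to the window and once to move
the competitor's risk forward, plus the generalization gap. -/
lemma integral_predictor_le {𝒵 Ω : Type*} [MeasurableSpace 𝒵] [MeasurableSpace Ω]
    {μ : Measure Ω} [IsProbabilityMeasure μ] {F : Set (𝒵 → ℝ)}
    (hF : ∀ f ∈ F, Measurable f ∧ ∀ z, f z ∈ Set.Icc (0 : ℝ) 1) {d : ℕ}
    (hFd : IsPseudoDim F d) (hd1 : 1 ≤ d) {Z : ℕ → Ω → 𝒵}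
    (hZ : ∀ t, 1 ≤ t → Measurable (Z t)) (hind : iIndepFun (fun t : ℕ+ => Z (t : ℕ)) μ)
    {Δ : ℕ → ℝ} (hΔ0 : ∀ t, 2 ≤ t → 0 ≤ Δ t)
    (hΔ : ∀ t, 2 ≤ t → discrepancy F (μ.map (Z t)) (μ.map (Z (t - 1))) ≤ Δ t)
    {t m : ℕ} (hm1 : 1 ≤ m) (hmt : m < t) (h : (Finset.Ico 1 t → 𝒵) → 𝒵 → ℝ)
    (hh : ∀ x, h x ∈ F) (hmeas : Measurable fun p : (Finset.Ico 1 t → 𝒵) × 𝒵 => h p.1 p.2)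
    {g : 𝒵 → ℝ} (hg : g ∈ F)
    (herm : ∀ᵐ ω ∂μ, ∑ s ∈ Finset.Icc (t - m) (t - 1), h (pastData Z t ω) (Z s ω) ≤
      ∑ s ∈ Finset.Icc (t - m) (t - 1), g (Z s ω)) :
    ∫ ω, h (pastData Z t ω) (Z t ω) ∂μ ≤ (∫ ω, g (Z t ω) ∂μ) +
      (2 * ∑ q ∈ Finset.Icc (t - m) (t - 1), Δ (q + 1) + 60 * Real.sqrt ((d : ℝ) / m)) := by
  have ht : 1 ≤ t := by omega
  have hprob : ∀ s, 1 ≤ s → IsProbabilityMeasure (μ.map (Z s)) := fun s hs =>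
    Measure.isProbabilityMeasure_map (hZ s hs).aemeasurable
  have hprobt := hprob t ht
  have hprobs : ∀ s : Finset.Ico 1 t, IsProbabilityMeasure (μ.map (Z s)) := fun s =>
    hprob s (Finset.mem_Ico.1 s.2).1
  set D := ∑ q ∈ Finset.Icc (t - m) (t - 1), Δ (q + 1) with hD
  set ν := Measure.pi fun s : Finset.Ico 1 t => μ.map (Z s) with hν
  have hX := measurable_pastData hZ t
  have hlaw : μ.map (pastData Z t) = ν := map_pastData_eq_pi hZ hind t
  have h01 : ∀ x z, h x z ∈ Set.Icc (0 : ℝ) 1 := fun x => (hF _ (hh x)).2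
  let W : Finset (Finset.Ico 1 t) := (Finset.Icc (t - m) (t - 1)).subtype (· ∈ Finset.Ico 1 t)
  have hWmem : ∀ s ∈ Finset.Icc (t - m) (t - 1), s ∈ Finset.Ico 1 t := by
    intro s hs
    rw [Finset.mem_Icc] at hs
    rw [Finset.mem_Ico]
    omega
  have hWsum : ∀ φ : ℕ → ℝ, ∑ s ∈ W, φ s = ∑ s ∈ Finset.Icc (t - m) (t - 1), φ s := fun φ =>
    Finset.sum_subtype_of_mem φ hWmem
  have hWcard : (W.card : ℝ) = m := by
    have := hWsum fun _ => 1
    simp only [Finset.sum_const, nsmul_eq_mul, mul_one, Nat.card_Icc] at this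
    rw [this]
    congr 1
    omega
  have hdrift : ∀ f ∈ F, ∀ s ∈ W, |(∫ z, f z ∂μ.map (Z t)) - ∫ z, f z ∂μ.map (Z s)| ≤ D := by
    intro f hf s hs
    have hs1 := Finset.mem_Ico.1 s.2
    have hs2 := Finset.mem_Icc.1 (Finset.mem_subtype.1 hs)
    refine (abs_integral_sub_integral_le_sum_drift hF (fun t => μ.map (Z t)) hprob Δ hΔ hf hs1.1
      hs1.2.le).trans ?_
    refine Finset.sum_le_sum_of_subset_of_nonneg ?_ fun q hq _ => hΔ0 _ ?_
    · intro q hq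
      rw [Finset.mem_Ico] at hq
      rw [Finset.mem_Icc]
      omega
    · rw [Finset.mem_Icc] at hq
      omega
  -- the inner risks, as functions of the past data
  have hriskmeas : ∀ s, 1 ≤ s → Measurable fun x => ∫ z, h x z ∂μ.map (Z s) := fun s hs => by
    have := hprob s hs
    exact (hmeas.stronglyMeasurable.integral_prod_right' (ν := μ.map (Z s))).measurable
  have hrisk : ∀ s, 1 ≤ s → Integrable (fun x => ∫ z, h x z ∂μ.map (Z s)) ν := fun s hs => by
    have := hprob s hs
    exact integrable_of_mem_Icc (hriskmeas s hs) fun x =>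
      integral_mem_Icc_of_mem_Icc (hF _ (hh x)).1 (h01 x)
  have hfit : ∀ s : Finset.Ico 1 t, Measurable fun x : Finset.Ico 1 t → 𝒵 => h x (x s) :=
    fun s => hmeas.comp (f := fun x : Finset.Ico 1 t → 𝒵 => (x, x s)) (by fun_prop)
  have hfitint : ∀ s : Finset.Ico 1 t, Integrable (fun x => h x (x s)) ν := fun s =>
    integrable_of_mem_Icc (hfit s) fun x => h01 _ _
  have hrisk' : ∀ s : Finset.Ico 1 t, Integrable (fun x => ∫ z, h x z ∂μ.map (Z s)) ν :=
    fun s => hrisk s (Finset.mem_Ico.1 s.2).1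
  have hpred : ∫ ω, h (pastData Z t ω) (Z t ω) ∂μ = ∫ x, ∫ z, h x z ∂μ.map (Z t) ∂ν := by
    have h1 : ∫ ω, h (pastData Z t ω) (Z t ω) ∂μ =
        ∫ p, h p.1 p.2 ∂μ.map (fun ω => (pastData Z t ω, Z t ω)) :=
      (integral_map (hX.prodMk (hZ t ht)).aemeasurable hmeas.aestronglyMeasurable).symm
    rw [h1, map_pastData_prodMk hZ hind ht]
    exact integral_prod _ (integrable_of_mem_Icc hmeas fun p => h01 _ _)
  have hback : m * ∫ x, ∫ z, h x z ∂μ.map (Z t) ∂ν ≤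
      (∫ x, ∑ s ∈ W, ∫ z, h x z ∂μ.map (Z s) ∂ν) + m * D := by
    have hc : (m : ℝ) * D = ∫ _x, (m : ℝ) * D ∂ν := by simp
    rw [hc, ← integral_const_mul, ← integral_add (integrable_finsetSum _ fun s _ => hrisk' s)
      (integrable_const _)]
    refine integral_mono ((hrisk t ht).const_mul _)
      ((integrable_finsetSum _ fun s _ => hrisk' s).add (integrable_const _)) fun x => ?_
    have : ∑ s ∈ W, ∫ z, h x z ∂μ.map (Z t) ≤ ∑ s ∈ W, ((∫ z, h x z ∂μ.map (Z s)) + D) :=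
      Finset.sum_le_sum fun s hs => by
        linarith [(abs_le.1 (hdrift _ (hh x) s hs)).2]
    simpa [Finset.sum_add_distrib, hWcard] using this
  have hgap : (∫ x, ∑ s ∈ W, ∫ z, h x z ∂μ.map (Z s) ∂ν) - ∫ x, ∑ s ∈ W, h x (x s) ∂ν ≤
      60 * Real.sqrt (d * m) := by
    rw [← integral_sub (integrable_finsetSum _ fun s _ => hrisk' s)
      (integrable_finsetSum _ fun s _ => hfitint s), ← hWcard]
    simp_rw [← Finset.sum_sub_distrib]
    exact hFd.integral_generalization_gap_le (fun f hf => (hF f hf).2) hd1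
      (fun s : Finset.Ico 1 t => μ.map (Z s)) W h hh hmeas
  have hgZ : ∀ s, 1 ≤ s → Integrable (fun ω => g (Z s ω)) μ := fun s hs =>
    integrable_of_mem_Icc ((hF g hg).1.comp (hZ s hs)) fun ω => (hF g hg).2 _
  have hgmap : ∀ s, 1 ≤ s → ∫ z, g z ∂μ.map (Z s) = ∫ ω, g (Z s ω) ∂μ := fun s hs =>
    integral_map (hZ s hs).aemeasurable (hF g hg).1.aestronglyMeasurable
  have hfiteq : ∫ x, ∑ s ∈ W, h x (x s) ∂ν ≤ ∑ s ∈ W, ∫ z, g z ∂μ.map (Z s) := by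
    rw [← hlaw, integral_map hX.aemeasurable
      (Finset.measurable_sum _ fun s _ => hfit s).aestronglyMeasurable]
    have h1 : ∀ s : Finset.Ico 1 t, 1 ≤ (s : ℕ) := fun s => (Finset.mem_Ico.1 s.2).1
    have hgZ' : ∀ s ∈ W, Integrable (fun ω => g (Z s ω)) μ := fun s _ => hgZ s (h1 s)
    rw [Finset.sum_congr rfl fun (s : Finset.Ico 1 t) _ => hgmap s (h1 s),
      ← integral_finsetSum _ hgZ']
    refine integral_mono_ae (integrable_finsetSum _ fun s _ =>
      integrable_of_mem_Icc ((hfit s).comp hX) fun ω => h01 _ _)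
      (integrable_finsetSum _ hgZ') ?_
    filter_upwards [herm] with ω hω
    rw [← hWsum fun s => h (pastData Z t ω) (Z s ω), ← hWsum fun s => g (Z s ω)] at hω
    exact hω
  have hforward : ∑ s ∈ W, ∫ z, g z ∂μ.map (Z s) ≤ m * (∫ z, g z ∂μ.map (Z t)) + m * D := by
    have : ∑ s ∈ W, ∫ z, g z ∂μ.map (Z s) ≤ ∑ s ∈ W, ((∫ z, g z ∂μ.map (Z t)) + D) :=
      Finset.sum_le_sum fun s hs => by
        linarith [(abs_le.1 (hdrift _ hg s hs)).1]
    simpa [Finset.sum_add_distrib, hWcard] using this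
  have hm0 : (0 : ℝ) < m := by exact_mod_cast hm1
  have hsqrt : Real.sqrt ((d : ℝ) * m) = m * Real.sqrt ((d : ℝ) / m) := by
    rw [show (d : ℝ) * m = m ^ 2 * (d / m) by field_simp, Real.sqrt_mul (by positivity),
      Real.sqrt_sq hm0.le]
  rw [hpred, ← hgmap t ht]
  rw [hsqrt] at hgap
  refine le_of_mul_le_mul_left ?_ hm0
  linarith

theorem theorem2 :
    -- a numerical constant, chosen before all the data of the problem
    ∃ c : ℝ, 0 < c ∧
      ∀ {𝒵 : Type*} [MeasurableSpace 𝒵] {Ω : Type*} [MeasurableSpace Ω]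
        (μ : Measure Ω) [IsProbabilityMeasure μ]
        -- the class of measurable functions into `[0, 1]` and its pseudo-dimension
        (F : Set (𝒵 → ℝ)) (_ : ∀ f ∈ F, Measurable f ∧ ∀ z, f z ∈ Set.Icc (0 : ℝ) 1)
        (d : ℕ) (_ : IsPseudoDim F d) (_ : 1 ≤ d)
        -- the independent data points `Z 1, Z 2, …` (`Z 0` is not used)
        (Z : ℕ → Ω → 𝒵) (_ : ∀ t, 1 ≤ t → Measurable (Z t))
        (_ : iIndepFun (fun t : ℕ+ => Z (t : ℕ)) μ)
        -- the drift bounds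
        (Δ : ℕ → ℝ)
        (_ : ∀ t, 2 ≤ t → Δ t ∈ Set.Icc (0 : ℝ) 1 ∧
          discrepancy F (μ.map (Z t)) (μ.map (Z (t - 1))) ≤ Δ t)
        -- the window lengths: any choice of minimizers of the criterion
        (m : ℕ → ℕ)
        (_ : ∀ t, 2 ≤ t → m t ∈ Finset.Icc 1 (t - 1) ∧
          ∀ k ∈ Finset.Icc 1 (t - 1), windowBound Δ d t (m t) ≤ windowBound Δ d t k)
        -- the predictors, as functions of the past data with values in the class
        (f : (t : ℕ) → (Finset.Ico 1 t → 𝒵) → 𝒵 → ℝ)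
        (_ : ∀ t, 1 ≤ t → ∀ x, f t x ∈ F)
        (_ : ∀ t, 1 ≤ t →
          Measurable (fun p : (Finset.Ico 1 t → 𝒵) × 𝒵 => f t p.1 p.2))
        -- empirical risk minimization over the last `m t` data points
        (_ : ∀ t, 2 ≤ t → ∀ᵐ ω ∂μ, ∀ g ∈ F,
          ∑ s ∈ Finset.Icc (t - m t) (t - 1), f t (pastData Z t ω) (Z s ω) ≤
            ∑ s ∈ Finset.Icc (t - m t) (t - 1), g (Z s ω))
        (T : ℕ) (_ : 2 ≤ T),
        (∑ t ∈ Finset.Icc 1 T, ∫ ω, f t (pastData Z t ω) (Z t ω) ∂μ) -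
            (∑ t ∈ Finset.Icc 1 T, ⨅ g : F, ∫ ω, g.1 (Z t ω) ∂μ) ≤
          c * ∑ t ∈ Finset.Icc 2 T,
            ⨅ k : Finset.Icc 1 (t - 1), windowBound Δ d t k := by
  refine ⟨61, by norm_num, ?_⟩
  intro 𝒵 _ Ω _ μ _ F hF d hFd hd1 Z hZ hind Δ hΔ m hm f hfF hfm herm T hT
  have hne : Nonempty F := ⟨⟨_, hfF 1 le_rfl fun s => absurd s.2 (by simp)⟩⟩
  have hinf0 : ∀ t, 0 ≤ ⨅ g : F, ∫ ω, g.1 (Z t ω) ∂μ := fun t =>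
    Real.iInf_nonneg fun g => integral_nonneg fun ω => ((hF g.1 g.2).2 _).1
  have hwin0 : ∀ t, ∀ k, k < t → 0 ≤ ∑ q ∈ Finset.Icc (t - k) (t - 1), Δ (q + 1) :=
    fun t k hk => Finset.sum_nonneg fun q hq => (hΔ _ (by rw [Finset.mem_Icc] at hq; omega)).1.1
  -- the empty first sample costs at most `1`, and the criterion at time `2` is at least `√d ≥ 1`
  have hfirst : ∫ ω, f 1 (pastData Z 1 ω) (Z 1 ω) ∂μ ≤ 1 :=
    (integral_mem_Icc_of_mem_Icc
      ((hfm 1 le_rfl).comp ((measurable_pastData hZ 1).prodMk (hZ 1 le_rfl)))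
      fun ω => (hF _ (hfF 1 le_rfl _)).2 _).2
  have hk : ∀ t, 2 ≤ t → Nonempty (Finset.Icc 1 (t - 1)) := fun t ht =>
    ⟨⟨1, by rw [Finset.mem_Icc]; omega⟩⟩
  have hW0 : ∀ t, 2 ≤ t → 0 ≤ ⨅ k : Finset.Icc 1 (t - 1), windowBound Δ d t k := fun t ht =>
    Real.iInf_nonneg fun k => add_nonneg
      (hwin0 t k (by have := Finset.mem_Icc.1 k.2; omega)) (Real.sqrt_nonneg _)
  have hW1 : 1 ≤ ∑ t ∈ Finset.Icc 2 T, ⨅ k : Finset.Icc 1 (t - 1), windowBound Δ d t k := by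
    have hmem : 2 ∈ Finset.Icc 2 T := Finset.mem_Icc.2 ⟨le_rfl, hT⟩
    have htwo : 1 ≤ ⨅ k : Finset.Icc 1 (2 - 1), windowBound Δ d 2 k := by
      have := hk 2 le_rfl
      refine le_ciInf fun k => ?_
      have hk1 : (k : ℕ) = 1 := by have := Finset.mem_Icc.1 k.2; omega
      have hsqrt : 1 ≤ Real.sqrt ((d : ℝ) / ((1 : ℕ) : ℝ)) :=
        Real.one_le_sqrt.2 (by simpa using hd1)
      have h0 := hwin0 2 1 (by omega)
      rw [hk1]
      unfold windowBound
      linarith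
    have hle : ∀ φ : ℕ → ℝ, (∀ t, 2 ≤ t → 0 ≤ φ t) → φ 2 ≤ ∑ t ∈ Finset.Icc 2 T, φ t :=
      fun φ hφ => Finset.single_le_sum (fun t ht => hφ t (Finset.mem_Icc.1 ht).1) hmem
    exact htwo.trans (hle _ hW0)
  have hstep : ∀ t ∈ Finset.Icc 2 T, (∫ ω, f t (pastData Z t ω) (Z t ω) ∂μ) -
      (⨅ g : F, ∫ ω, g.1 (Z t ω) ∂μ) ≤
        60 * ⨅ k : Finset.Icc 1 (t - 1), windowBound Δ d t k := by
    intro t ht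
    have ht2 := (Finset.mem_Icc.1 ht).1
    have ht1 : 1 ≤ t := by omega
    have hmt := Finset.mem_Icc.1 (hm t ht2).1
    have := hk t ht2
    have hmin : windowBound Δ d t (m t) ≤ ⨅ k : Finset.Icc 1 (t - 1), windowBound Δ d t k :=
      le_ciInf fun k => (hm t ht2).2 k k.2
    have hinf : (∫ ω, f t (pastData Z t ω) (Z t ω) ∂μ) - 60 * windowBound Δ d t (m t) ≤
        ⨅ g : F, ∫ ω, g.1 (Z t ω) ∂μ := by
      refine le_ciInf fun g => ?_
      have h := integral_predictor_le hF hFd hd1 hZ hind (fun t ht => (hΔ t ht).1.1)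
        (fun t ht => (hΔ t ht).2) hmt.1 (by omega : m t < t) (f t) (hfF t ht1) (hfm t ht1) g.2
        ((herm t ht2).mono fun ω hω => hω g.1 g.2)
      have h0 := hwin0 t (m t) (by omega)
      unfold windowBound
      linarith
    linarith
  have hsplit : Finset.Icc 1 T = insert 1 (Finset.Icc 2 T) := by
    ext t
    simp only [Finset.mem_insert, Finset.mem_Icc]
    omega
  have hsum := Finset.sum_le_sum hstep
  rw [← Finset.mul_sum] at hsum
  rw [← Finset.sum_sub_distrib, hsplit, Finset.sum_insert (by simp)]
  linarith [hinf0 1]
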